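/- Let $X$ be a locally compact Hausdorff space. A \emph{deficient topological measure} (DTM) on $X$ is a set function $\nu$, defined on the open and the closed subsets of $X$, with values in $[0,\infty]$ and not identically $\infty$, such that $\nu(C\sqcup K)=\nu(C)+\nu(K)$ for disjoint compact $C,K$; $\nu(U)=\sup\{\nu(C): C\subseteq U,\ C \text{ compact}\}$ for $U$ open; and $\nu(F)=\inf\{\nu(U): F\subseteq U,\ U\text{ open}\}$ for $F$ closed. It is a \emph{topological measure} (TM) if moreover $\nu(A\sqcup B)=\nu(A)+\nu(B)$ whenever $A,B$ are disjoint and each of $A$, $B$, $A\sqcup B$ is compact or open. It is \emph{finite} if $\nu(X)<\infty$. Let $\mathbf{DTM}(X)$ and $\mathbf{TM}(X)$ be the sets of finite DTMs and finite TMs, and let $\mathbf{M}(X)\subseteq\mathbf{TM}(X)\subseteq\mathbf{DTM}(X)$ be the set of restrictions to open and closed sets of finite Borel measures that are inner (compact) regular on open sets and outer regular on all Borel sets; a finite DTM "is a measure" if it lies in $\mathbf{M}(X)$. A Radon measure is a Borel measure that is finite on compact sets, outer regular on all Borel sets, and inner (compact) regular on open sets. A DTM $\nu$ is \emph{proper}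 if the only Radon measure $m$ with $m\le\nu$ on open and closed sets is $m=0$. The set $\mathbf{DTM}(X)$ carries the weak topology, i.e. the coarsest topology making $\mu\mapsto\int f\,d\mu:=\int_0^{\|f\|}\mu(\{x: f(x)>t\})\,dt$ continuous for every nonnegative continuous function $f$ on $X$ vanishing at infinity; $\mathbf{TM}(X)$ carries the subspace topology. (i) The following are equivalent: $\mathbf{M}(X)$ is nowhere dense in $\mathbf{DTM}(X)$; there is a finite DTM that is not a measure; there is a nonzero finite proper DTM. (ii) The following are equivalent: $\mathbf{M}(X)$ is nowhere dense in $\mathbf{TM}(X)$; there is a finite TM that is not a measure; there is a nonzero finite proper TM. (iii) The following are equivalent: $\mathbf{TM}(X)$ is nowhere dense in $\mathbf{DTM}(X)$; there is a finite DTM that is not a TM; there is a nonzero finite proper DTM that is not a TM. (iv) If $X$ contains a compact connected set with more than one point, then $\mathbf{M}(X)$ is nowhere dense in $\mathbf{DTM}(X)$ and $\mathbf{TM}(X)$ is nowhere dense in $\mathbf{DTM}(X)$. -/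

import Mathlib

open scoped ENNReal ZeroAtInfty

namespace TopMeas

/-- The family of all subsets of `X` that are open or closed: the domain of a
(deficient) topological measure. -/
def OC (X : Type*) [TopologicalSpace X] : Type _ := {A : Set X // IsOpen A ∨ IsClosed A}

/-- The whole space as a member of the family. -/
def OC.univ (X : Type*) [TopologicalSpace X] : OC X := ⟨Set.univ, Or.inl isOpen_univ⟩

/-- A deficient topological measure: a `[0, ∞]`-valued set function on open and closed sets, not
identically `∞`, finitely additive on compact sets, inner compact regular on open sets and outer
regular on closed sets. -/
structure IsDTM {X : Type*} [TopologicalSpace X] (ν : OC X → ℝ≥0∞) : Prop where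
  exists_ne_top : ∃ A, ν A ≠ ∞
  add : ∀ C K D : OC X, IsCompact C.1 → IsCompact K.1 → Disjoint C.1 K.1 →
    D.1 = C.1 ∪ K.1 → ν D = ν C + ν K
  inner : ∀ U : OC X, IsOpen U.1 →
    ν U = ⨆ (C : OC X) (_ : C.1 ⊆ U.1) (_ : IsCompact C.1), ν C
  outer : ∀ F : OC X, IsClosed F.1 →
    ν F = ⨅ (U : OC X) (_ : F.1 ⊆ U.1) (_ : IsOpen U.1), ν U

/-- A topological measure: as above, with additivity required whenever the two disjoint sets and
their union are each compact or open. -/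
structure IsTM {X : Type*} [TopologicalSpace X] (μ : OC X → ℝ≥0∞) : Prop where
  exists_ne_top : ∃ A, μ A ≠ ∞
  add : ∀ A B D : OC X, (IsCompact A.1 ∨ IsOpen A.1) → (IsCompact B.1 ∨ IsOpen B.1) →
    (IsCompact D.1 ∨ IsOpen D.1) → Disjoint A.1 B.1 → D.1 = A.1 ∪ B.1 → μ D = μ A + μ B
  inner : ∀ U : OC X, IsOpen U.1 →
    μ U = ⨆ (K : OC X) (_ : K.1 ⊆ U.1) (_ : IsCompact K.1), μ K
  outer : ∀ F : OC X, IsClosed F.1 →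
    μ F = ⨅ (U : OC X) (_ : F.1 ⊆ U.1) (_ : IsOpen U.1), μ U

/-- Every topological measure is a deficient topological measure. -/
theorem IsTM.isDTM {X : Type*} [TopologicalSpace X] {μ : OC X → ℝ≥0∞} (h : IsTM μ) :
    IsDTM μ where
  exists_ne_top := h.exists_ne_top
  add C K D hC hK hd hD := h.add C K D (Or.inl hC) (Or.inl hK)
    (Or.inl (by rw [hD]; exact hC.union hK)) hd hD
  inner := h.inner
  outer := h.outer

/-- `𝐃𝐓𝐌(X)`: the finite deficient topological measures on `X`. -/
structure DTM (X : Type*) [TopologicalSpace X] where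
  /-- the underlying set function -/
  toFun : OC X → ℝ≥0∞
  isDTM : IsDTM toFun
  finite : toFun (OC.univ X) < ∞

/-- `𝐓𝐌(X)`: the finite topological measures on `X`, as a subset of `𝐃𝐓𝐌(X)`. -/
def TM (X : Type*) [TopologicalSpace X] : Set (DTM X) := {ν | IsTM ν.toFun}

/-- `m` is inner compact regular on open sets and outer regular on all Borel sets. (There is no
condition on the values at compact sets.) -/
structure IsRegularBorel {X : Type*} [TopologicalSpace X] [MeasurableSpace X]
    (m : MeasureTheory.Measure X) : Prop where
  inner : ∀ U : Set X, IsOpen U → m U = ⨆ (K : Set X) (_ : K ⊆ U) (_ : IsCompact K), m K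
  outer : ∀ E : Set X, MeasurableSet E → m E = ⨅ (U : Set X) (_ : E ⊆ U) (_ : IsOpen U), m U

/-- A Radon measure: a compact-finite Borel measure, inner compact regular on open sets and outer
regular on all Borel sets. -/
structure IsRadon {X : Type*} [TopologicalSpace X] [MeasurableSpace X]
    (m : MeasureTheory.Measure X) : Prop extends IsRegularBorel m where
  compact_finite : ∀ K : Set X, IsCompact K → m K < ∞

/-- The restriction of a measure to open and closed sets. -/
def restrictOC {X : Type*} [TopologicalSpace X] [MeasurableSpace X]
    (m : MeasureTheory.Measure X) : OC X → ℝ≥0∞ := fun A => m A.1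

/-- The restriction of a finite (regular) measure is a topological measure. -/
theorem IsRegularBorel.isTM {X : Type*} [TopologicalSpace X] [T2Space X] [MeasurableSpace X]
    [BorelSpace X] {m : MeasureTheory.Measure X} (h : IsRegularBorel m) :
    IsTM (restrictOC m) where
  exists_ne_top := ⟨⟨∅, Or.inl isOpen_empty⟩, by simp [restrictOC]⟩
  add A B D _ _ _ hd hD := by
    have hB : MeasurableSet B.1 := B.2.elim IsOpen.measurableSet IsClosed.measurableSet
    simp only [restrictOC, hD, MeasureTheory.measure_union hd hB]
  inner U hU := by
    simp only [restrictOC]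
    rw [h.inner U.1 hU]
    apply le_antisymm
    · exact iSup_le fun K => iSup₂_le fun hKU hK =>
        le_iSup_of_le (⟨K, Or.inr hK.isClosed⟩ : OC X) (le_iSup₂_of_le hKU hK le_rfl)
    · exact iSup_le fun K => iSup₂_le fun hKU hK =>
        le_iSup_of_le K.1 (le_iSup₂_of_le hKU hK le_rfl)
  outer F hF := by
    simp only [restrictOC]
    rw [h.outer F.1 hF.measurableSet]
    apply le_antisymm
    · exact le_iInf fun U => le_iInf₂ fun hU ho =>
        iInf_le_of_le U.1 (iInf₂_le_of_le hU ho le_rfl)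
    · exact le_iInf fun U => le_iInf₂ fun hU ho =>
        iInf_le_of_le (⟨U, Or.inl ho⟩ : OC X) (iInf₂_le_of_le hU ho le_rfl)

/-- `𝐌(X)`: the restrictions to open and closed sets of the finite Borel measures that are inner
regular on open sets and outer regular on Borel sets, as a subset of `𝐃𝐓𝐌(X)`. -/
def M (X : Type*) [TopologicalSpace X] [MeasurableSpace X] : Set (DTM X) :=
  {ν | ∃ m : MeasureTheory.Measure X, IsRegularBorel m ∧ ν.toFun = restrictOC m}

/-- `ν` is proper if the only Radon measure `m` with `m ≤ ν` on open and closed sets is `0`. -/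
def IsProper {X : Type*} [TopologicalSpace X] [MeasurableSpace X] (ν : OC X → ℝ≥0∞) : Prop :=
  ∀ m : MeasureTheory.Measure X, IsRadon m → restrictOC m ≤ ν → m = 0

/-- `C₀⁺(X)`: the nonnegative continuous functions vanishing at infinity. -/
def C0Plus (X : Type*) [TopologicalSpace X] : Type _ := {f : C₀(X, ℝ) // ∀ x, 0 ≤ f x}

/-- The open set `f⁻¹((t, ∞))`. -/
def superlevel {X : Type*} [TopologicalSpace X] (f : C₀(X, ℝ)) (t : ℝ) : OC X :=
  ⟨{x | t < f x}, Or.inl (isOpen_lt continuous_const f.continuous)⟩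

/-- The quasi-integral `∫ f dμ = ∫₀ᵇ μ(f⁻¹((t, ∞))) dt` of `f ∈ C₀⁺(X)`, where `f(X) ⊆ [0, b]`;
here `b = ‖f‖`, the supremum norm. -/
noncomputable def quasiIntegral {X : Type*} [TopologicalSpace X] (μ : DTM X) (f : C0Plus X) : ℝ :=
  ∫ t in (0 : ℝ)..‖f.1‖, (μ.toFun (superlevel f.1 t)).toReal

/-- The weak topology on `𝐃𝐓𝐌(X)`: the coarsest one for which all the maps
`μ ↦ ∫ f dμ`, `f ∈ C₀⁺(X)`, are continuous. -/
noncomputable instance weakTopology (X : Type*) [TopologicalSpace X] :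
    TopologicalSpace (DTM X) :=
  ⨅ f : C0Plus X, TopologicalSpace.induced (fun μ => quasiIntegral μ f) inferInstance

end TopMeas

namespace TopMeas

open MeasureTheory Filter Topology

/-! ### Monotonicity, superadditivity and additivity of set functions -/

section SetFunctions

variable {X : Type*} [TopologicalSpace X] {ν : OC X → ℝ≥0∞}

/-! Both `M X` and `TM X` are closed cones cut out by weakly closed conditions. A finite DTM is a
measure exactly when its quasi-integral is subadditive on all sums `g = f + h`, and a TM exactly
when this holds for those sums with `g ≤ 1` and `g = 1` wherever `f ≠ 0`
(`mem_M_of_quasiIntegral_le`, `mem_TM_of_quasiIntegral_le`). On members of the two classes equality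
holds in these conditions.

Because of the equality, one outsider `ν` spoils every member `μ`: `μ + c ν` is an outsider for each
`c ≠ 0`, and it tends weakly to `μ` as `c → 0`. A closed set all of whose points are such limits has
empty interior, so nowhere density amounts to the existence of an outsider.

Outsiders become proper by exhaustion: repeatedly subtracting from `ν` a measure of at least half
the largest available mass leaves a proper remainder (`DTM.exists_isProper_subMeasure`). The
remainder is a TM exactly when `ν` is, and it vanishes only if `ν` is a measure. Conversely, a
nonzero proper DTM is not a measure, since it would itself be a Radon measure below it.

For a nondegenerate compact connected `K`, the indicator of "contains `K`" is a DTM that is not a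
TM. -/

theorem IsDTM.mono_closed_open (h : IsDTM ν) {F U : OC X} (hF : IsClosed F.1) (hU : IsOpen U.1)
    (hFU : F.1 ⊆ U.1) : ν F ≤ ν U := by
  rw [h.outer F hF]
  exact iInf_le_of_le U (iInf₂_le_of_le hFU hU le_rfl)

theorem IsDTM.mono (h : IsDTM ν) {A B : OC X} (hAB : A.1 ⊆ B.1) : ν A ≤ ν B := by
  have key : ∀ (V : OC X), IsOpen V.1 → A.1 ⊆ V.1 → ν A ≤ ν V := by
    intro V hV hAV
    rcases A.2 with hA | hA
    · rw [h.inner A hA, h.inner V hV]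
      exact iSup_mono fun C => iSup₂_le fun hC hc => le_iSup₂_of_le (hC.trans hAV) hc le_rfl
    · exact h.mono_closed_open hA hV hAV
  rcases B.2 with hB | hB
  · exact key B hB hAB
  · rw [h.outer B hB]
    exact le_iInf fun V => le_iInf₂ fun hV ho => key V ho (hAB.trans hV)

theorem IsDTM.congr_of_open {μ : OC X → ℝ≥0∞} (hμ : IsDTM μ) (hν : IsDTM ν)
    (h : ∀ U : OC X, IsOpen U.1 → μ U = ν U) : μ = ν := by
  funext A
  rcases A.2 with hA | hA
  · exact h A hA
  · rw [hμ.outer A hA, hν.outer A hA]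
    exact iInf_congr fun U => iInf_congr fun _ => iInf_congr fun ho => h U ho

/-- Approximation form of the regularity conditions on a set function. -/
structure IsRegularSetFun (ν : OC X → ℝ≥0∞) : Prop where
  mono : ∀ F U : OC X, IsClosed F.1 → IsOpen U.1 → F.1 ⊆ U.1 → ν F ≤ ν U
  inner : ∀ U : OC X, IsOpen U.1 → ∀ ε : ℝ≥0∞, ε ≠ 0 →
    ∃ K : OC X, K.1 ⊆ U.1 ∧ IsCompact K.1 ∧ ν U ≤ ν K + ε
  outer : ∀ F : OC X, IsClosed F.1 → ∀ ε : ℝ≥0∞, ε ≠ 0 →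
    ∃ U : OC X, F.1 ⊆ U.1 ∧ IsOpen U.1 ∧ ν U ≤ ν F + ε

theorem IsRegularSetFun.inner_eq [T2Space X] (h : IsRegularSetFun ν) (U : OC X)
    (hU : IsOpen U.1) : ν U = ⨆ (C : OC X) (_ : C.1 ⊆ U.1) (_ : IsCompact C.1), ν C := by
  apply le_antisymm
  · refine ENNReal.le_of_forall_pos_le_add fun ε hε _ => ?_
    obtain ⟨K, hKU, hK, hle⟩ := h.inner U hU ε (by simpa using hε.ne')
    exact hle.trans (add_le_add_left (le_iSup_of_le K (le_iSup_of_le hKU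
      (le_iSup (fun _ : IsCompact K.1 => ν K) hK))) _)
  · exact iSup_le fun K => iSup₂_le fun hKU hK => h.mono K U hK.isClosed hU hKU

theorem IsRegularSetFun.outer_eq (h : IsRegularSetFun ν) (F : OC X)
    (hF : IsClosed F.1) : ν F = ⨅ (U : OC X) (_ : F.1 ⊆ U.1) (_ : IsOpen U.1), ν U := by
  apply le_antisymm
  · exact le_iInf fun U => le_iInf₂ fun hFU hU => h.mono F U hF hU hFU
  · refine ENNReal.le_of_forall_pos_le_add fun ε hε _ => ?_
    obtain ⟨U, hFU, hU, hle⟩ := h.outer F hF ε (by simpa using hε.ne')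
    exact (iInf_le_of_le U (iInf₂_le_of_le hFU hU le_rfl)).trans hle

theorem IsDTM.ne_top (h : IsDTM ν) (hfin : ν (OC.univ X) < ∞) (A : OC X) : ν A ≠ ∞ :=
  ((h.mono (Set.subset_univ A.1)).trans_lt hfin).ne

theorem IsDTM.empty (h : IsDTM ν) (hfin : ν (OC.univ X) < ∞) {E : OC X} (hE : E.1 = ∅) :
    ν E = 0 := by
  have hc : IsCompact E.1 := hE ▸ isCompact_empty
  have := h.add E E E hc hc (by simp [hE]) (by simp)
  have hne := h.ne_top hfin E
  exact (ENNReal.add_right_inj hne).1 (by rw [add_zero]; exact this.symm)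

theorem IsDTM.isRegularSetFun (h : IsDTM ν) (hfin : ν (OC.univ X) < ∞) :
    IsRegularSetFun ν where
  mono F U hF hU hFU := h.mono hFU
  inner U hU ε hε := by
    by_contra! hcon
    have hle : ν U + ε ≤ ν U := by
      have : ν U ≤ ν U - ε := by
        conv_lhs => rw [h.inner U hU]
        exact iSup_le fun K => iSup₂_le fun hKU hK =>
          ENNReal.le_sub_of_add_le_right (fun hε' => by
            have := hcon K hKU hK
            simp [hε'] at this) (hcon K hKU hK).le
      have h0 : ν U ≠ 0 := by
        intro h0
        have := hcon ⟨∅, Or.inl isOpen_empty⟩ (Set.empty_subset _) isCompact_empty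
        simp [h0] at this
      exact absurd this (not_le.2 (ENNReal.sub_lt_self (h.ne_top hfin U) h0 hε))
    exact absurd hle (not_le.2 (ENNReal.lt_add_right (h.ne_top hfin U) hε))
  outer F hF ε hε := by
    have hlt := ENNReal.lt_add_right (h.ne_top hfin F) hε
    conv_lhs at hlt => rw [h.outer F hF]
    simp only [iInf_lt_iff] at hlt
    obtain ⟨U, hFU, hU, hlt⟩ := hlt
    exact ⟨U, hFU, hU, hlt.le⟩

theorem IsDTM.exists_compact_subset (h : IsDTM ν) (hfin : ν (OC.univ X) < ∞) {A : OC X}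
    (hA : IsCompact A.1 ∨ IsOpen A.1) {ε : ℝ≥0∞} (hε : ε ≠ 0) :
    ∃ K : OC X, K.1 ⊆ A.1 ∧ IsCompact K.1 ∧ ν A ≤ ν K + ε := by
  rcases hA with hA | hA
  · exact ⟨A, subset_rfl, hA, le_self_add⟩
  · exact (h.isRegularSetFun hfin).inner A hA ε hε

/-- Superadditivity of a deficient topological measure. -/
theorem IsDTM.add_le [T2Space X] (h : IsDTM ν) (hfin : ν (OC.univ X) < ∞) {A B D : OC X}
    (hA : IsCompact A.1 ∨ IsOpen A.1) (hB : IsCompact B.1 ∨ IsOpen B.1)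
    (hAB : Disjoint A.1 B.1) (hAD : A.1 ⊆ D.1) (hBD : B.1 ⊆ D.1) : ν A + ν B ≤ ν D := by
  refine ENNReal.le_of_forall_pos_le_add fun ε hε _ => ?_
  have hε' : ((ε : ℝ≥0∞) / 2) ≠ 0 := by simpa using hε.ne'
  obtain ⟨K, hKA, hK, hle⟩ := h.exists_compact_subset hfin hA hε'
  obtain ⟨L, hLB, hL, hle'⟩ := h.exists_compact_subset hfin hB hε'
  have hadd := h.add K L ⟨K.1 ∪ L.1, Or.inr (hK.union hL).isClosed⟩ hK hL
    (hAB.mono hKA hLB) rfl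
  calc ν A + ν B ≤ (ν K + ε / 2) + (ν L + ε / 2) := add_le_add hle hle'
    _ = (ν K + ν L) + (ε / 2 + ε / 2) := by abel
    _ ≤ ν D + ε := by
      rw [ENNReal.add_halves, ← hadd]
      exact add_le_add_left (h.mono (Set.union_subset (hKA.trans hAD) (hLB.trans hBD))) _

/-- Allows `A` to be closed but not compact, a case outside `IsDTM.add_le`: with `B` replaced by a
compact `K` inside it, `A` sits in the open set `D \ K`. -/
theorem IsDTM.add_le_open [T2Space X] (h : IsDTM ν) (hfin : ν (OC.univ X) < ∞) {A B D : OC X}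
    (hB : IsOpen B.1) (hD : IsOpen D.1)
    (hAB : Disjoint A.1 B.1) (hAD : A.1 ⊆ D.1) (hBD : B.1 ⊆ D.1) : ν A + ν B ≤ ν D := by
  refine ENNReal.le_of_forall_pos_le_add fun ε hε _ => ?_
  obtain ⟨K, hKB, hK, hle⟩ := h.exists_compact_subset hfin (Or.inr hB)
    (ε := ε) (by simpa using hε.ne')
  have hDK : IsOpen (D.1 \ K.1) := hD.sdiff hK.isClosed
  have h1 : ν A ≤ ν ⟨D.1 \ K.1, Or.inl hDK⟩ :=
    h.mono fun x hx => ⟨hAD hx, fun hxK => hAB.le_bot ⟨hx, hKB hxK⟩⟩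
  calc ν A + ν B ≤ ν ⟨D.1 \ K.1, Or.inl hDK⟩ + (ν K + ε) := add_le_add h1 hle
    _ = (ν ⟨D.1 \ K.1, Or.inl hDK⟩ + ν K) + ε := by abel
    _ ≤ ν D + ε := add_le_add_left
      (h.add_le hfin (Or.inr hDK) (Or.inl hK) Set.disjoint_sdiff_left Set.sdiff_subset
        (hKB.trans hBD)) _

/-- A deficient topological measure is additive on disjoint open sets. -/
theorem IsDTM.add_open [T2Space X] (h : IsDTM ν) (hfin : ν (OC.univ X) < ∞) {U V D : OC X}
    (hU : IsOpen U.1) (hV : IsOpen V.1) (hUV : Disjoint U.1 V.1) (hD : D.1 = U.1 ∪ V.1) :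
    ν D = ν U + ν V := by
  have hDo : IsOpen D.1 := hD ▸ hU.union hV
  refine le_antisymm ?_ (h.add_le hfin (Or.inr hU) (Or.inr hV) hUV
    (hD ▸ Set.subset_union_left) (hD ▸ Set.subset_union_right))
  rw [h.inner D hDo]
  refine iSup_le fun K => iSup₂_le fun hKD hK => ?_
  have hKV := hK.diff hV
  have hKU := hK.diff hU
  -- As `K ⊆ U ∪ V` with `U`, `V` disjoint, `K \ V` and `K \ U` are disjoint compact pieces of `K`,
  -- one in `U` and one in `V`.
  rw [h.add ⟨K.1 \ V.1, Or.inr hKV.isClosed⟩ ⟨K.1 \ U.1, Or.inr hKU.isClosed⟩ K hKV hKU]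
  · refine add_le_add (h.mono ?_) (h.mono ?_)
    · rintro x ⟨hx, hxV⟩
      have := hKD hx
      rw [hD] at this
      exact this.resolve_right hxV
    · rintro x ⟨hx, hxU⟩
      have := hKD hx
      rw [hD] at this
      exact this.resolve_left hxU
  · rw [Set.disjoint_left]
    rintro x ⟨hx, hxV⟩ ⟨_, hxU⟩
    have := hKD hx
    rw [hD] at this
    exact this.elim hxU hxV
  · ext x
    simp only [Set.mem_union, Set.mem_sdiff]
    have : x ∈ U.1 → x ∉ V.1 := fun hx hx' => hUV.le_bot ⟨hx, hx'⟩
    tauto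

/-- It suffices to check the additivity of a topological measure on an open set and a compact
subset. -/
theorem IsDTM.isTM_of_le [T2Space X] (h : IsDTM ν) (hfin : ν (OC.univ X) < ∞)
    (hsub : ∀ C U V : OC X, IsCompact C.1 → IsOpen U.1 → C.1 ⊆ U.1 → V.1 = U.1 \ C.1 →
      ν U ≤ ν C + ν V) : IsTM ν where
  exists_ne_top := h.exists_ne_top
  inner := h.inner
  outer := h.outer
  add := by
    have hdiff : ∀ C U V : OC X, IsCompact C.1 → IsOpen U.1 → C.1 ⊆ U.1 → V.1 = U.1 \ C.1 →
        ν U = ν C + ν V := fun C U V hC hU hCU hV =>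
      (hsub C U V hC hU hCU hV).antisymm (h.add_le hfin (Or.inl hC)
        (Or.inr (hV ▸ hU.sdiff hC.isClosed)) (hV ▸ Set.disjoint_sdiff_right) hCU
        (hV ▸ Set.sdiff_subset))
    have hmix : ∀ A B D : OC X, IsCompact A.1 → IsOpen B.1 → (IsCompact D.1 ∨ IsOpen D.1) →
        Disjoint A.1 B.1 → D.1 = A.1 ∪ B.1 → ν D = ν A + ν B := by
      intro A B D hA hB hD hAB hDAB
      rcases hD with hD | hD
      -- For compact `D`, pass to complements: `Aᶜ` is the disjoint union of the open sets `B` and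
      -- `Dᶜ`, and the finite value at `Dᶜ` cancels.
      · have hDc : IsOpen D.1ᶜ := hD.isClosed.isOpen_compl
        have hAc : IsOpen A.1ᶜ := hA.isClosed.isOpen_compl
        have h1 := hdiff D (OC.univ X) ⟨D.1ᶜ, Or.inl hDc⟩ hD isOpen_univ (Set.subset_univ _)
          (Set.compl_eq_univ_sdiff _)
        have h2 := hdiff A (OC.univ X) ⟨A.1ᶜ, Or.inl hAc⟩ hA isOpen_univ (Set.subset_univ _)
          (Set.compl_eq_univ_sdiff _)
        have h3 := h.add_open hfin (U := B) (V := ⟨D.1ᶜ, Or.inl hDc⟩)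
          (D := ⟨A.1ᶜ, Or.inl hAc⟩) hB hDc
          (Set.disjoint_compl_right_iff_subset.2 (hDAB ▸ Set.subset_union_right)) (by
            ext x
            have : x ∈ A.1 → x ∉ B.1 := fun hx hx' => hAB.le_bot ⟨hx, hx'⟩
            simp only [hDAB, Set.mem_compl_iff, Set.mem_union]
            tauto)
        refine (ENNReal.add_left_inj (h.ne_top hfin ⟨D.1ᶜ, Or.inl hDc⟩)).1 ?_
        rw [← h1, h2, h3, add_assoc]
      · exact hdiff A D B hA hD (hDAB ▸ Set.subset_union_left) (by
          rw [hDAB, Set.union_sdiff_left, hAB.symm.sdiff_eq_left])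
    intro A B D hA hB hD hAB hDAB
    rcases hA with hA | hA <;> rcases hB with hB | hB
    · exact h.add A B D hA hB hAB hDAB
    · exact hmix A B D hA hB hD hAB hDAB
    · rw [add_comm]
      exact hmix B A D hB hA hD hAB.symm (by rw [hDAB, Set.union_comm])
    · exact h.add_open hfin hA hB hAB hDAB

end SetFunctions

/-! ### Measures below a set function -/

section Preliminaries

theorem ennreal_add_sub_add_of_le {a b c d : ℝ≥0∞} (hca : c ≤ a) (hdb : d ≤ b)
    (hc : c ≠ ∞) (hd : d ≠ ∞) : (a + b) - (c + d) = (a - c) + (b - d) := by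
  obtain ⟨a, rfl⟩ := le_iff_exists_add.1 hca
  obtain ⟨b, rfl⟩ := le_iff_exists_add.1 hdb
  rw [ENNReal.add_sub_cancel_left hc, ENNReal.add_sub_cancel_left hd, add_add_add_comm,
    ENNReal.add_sub_cancel_left (ENNReal.add_ne_top.2 ⟨hc, hd⟩)]

variable {X : Type*} [TopologicalSpace X] [MeasurableSpace X]

theorem measure_ne_top_of_le {ν : DTM X} {m : Measure X} (hle : restrictOC m ≤ ν.toFun)
    (A : Set X) : m A ≠ ∞ :=
  ((measure_mono (Set.subset_univ A)).trans_lt ((hle (OC.univ X)).trans_lt ν.finite)).ne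

/-- The supremum of the total masses of the regular measures below `ν`. -/
noncomputable def measureMass (ν : OC X → ℝ≥0∞) : ℝ≥0∞ :=
  ⨆ (m : Measure X) (_ : IsRegularBorel m ∧ restrictOC m ≤ ν), m Set.univ

theorem le_measureMass {ν : OC X → ℝ≥0∞} {m : Measure X} (hm : IsRegularBorel m)
    (hle : restrictOC m ≤ ν) : m Set.univ ≤ measureMass ν :=
  le_iSup₂_of_le (f := fun (m : Measure X) (_ : IsRegularBorel m ∧ restrictOC m ≤ ν) =>
    m Set.univ) m ⟨hm, hle⟩ le_rfl

theorem restrictOC_union [BorelSpace X] {m : Measure X} {A B D : OC X}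
    (hAB : Disjoint A.1 B.1) (hD : D.1 = A.1 ∪ B.1) :
    restrictOC m D = restrictOC m A + restrictOC m B := by
  have hB : MeasurableSet B.1 := B.2.elim IsOpen.measurableSet IsClosed.measurableSet
  simp only [restrictOC, hD, measure_union hAB hB]

/-- Inner regularity on all measurable sets is the form of regularity that passes to the infinite
sum in the exhaustion. -/
theorem IsRegularBorel.innerRegular {m : Measure X} [IsFiniteMeasure m] (h : IsRegularBorel m) :
    m.InnerRegular := by
  have : m.Regular :=
    { outerRegular := fun A hA r hr => by
        rw [h.outer A hA] at hr
        simp only [gt_iff_lt, iInf_lt_iff] at hr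
        obtain ⟨U, hAU, hU, hr⟩ := hr
        exact ⟨U, hAU, hU, hr⟩
      innerRegular := fun U hU r hr => by
        rw [h.inner U hU] at hr
        simp only [lt_iSup_iff] at hr
        obtain ⟨K, hKU, hK, hr⟩ := hr
        exact ⟨K, hKU, hK, hr⟩ }
  infer_instance

end Preliminaries

/-! ### Sums and differences of deficient topological measures -/

section Constructions

variable {X : Type*} [TopologicalSpace X] [T2Space X]

theorem IsRegularSetFun.add_smul {μ ν : OC X → ℝ≥0∞} (hμ : IsRegularSetFun μ)
    (hν : IsRegularSetFun ν) (hμm : ∀ A B : OC X, A.1 ⊆ B.1 → μ A ≤ μ B)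
    (hνm : ∀ A B : OC X, A.1 ⊆ B.1 → ν A ≤ ν B) (c : NNReal) :
    IsRegularSetFun (fun A => μ A + c * ν A) := by
  -- An error `δ` for each summand costs `(1 + c) δ` in `μ + c ν`, hence `δ = ε / (1 + c)`.
  have hc : ∀ ε : ℝ≥0∞, ε ≠ 0 → ε / (1 + c) ≠ 0 := fun ε hε => by
    simp [ENNReal.div_eq_zero_iff, hε]
  have hc' : ∀ (ε a b : ℝ≥0∞), (a + ε / (1 + c)) + c * (b + ε / (1 + c)) = a + c * b + ε := by
    intro ε a b
    have : (1 + (c : ℝ≥0∞)) * (ε / (1 + c)) = ε :=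
      ENNReal.mul_div_cancel (by simp) (by simp)
    calc (a + ε / (1 + c)) + c * (b + ε / (1 + c))
        = a + c * b + (1 + (c : ℝ≥0∞)) * (ε / (1 + c)) := by ring
      _ = _ := by rw [this]
  refine ⟨fun F U _ _ hFU => ?_, fun U hU ε hε => ?_, fun F hF ε hε => ?_⟩
  · have h1 := hμm F U hFU
    have h2 := hνm F U hFU
    gcongr
  · obtain ⟨K, hKU, hK, hle⟩ := hμ.inner U hU _ (hc ε hε)
    obtain ⟨L, hLU, hL, hle'⟩ := hν.inner U hU _ (hc ε hε)
    let N : OC X := ⟨K.1 ∪ L.1, Or.inr (hK.union hL).isClosed⟩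
    refine ⟨N, Set.union_subset hKU hLU, hK.union hL, ?_⟩
    rw [← hc']
    have h1 := hμm K N Set.subset_union_left
    have h2 := hνm L N Set.subset_union_right
    gcongr
    · exact hle.trans (by gcongr)
    · exact hle'.trans (by gcongr)
  · obtain ⟨U, hFU, hU, hle⟩ := hμ.outer F hF _ (hc ε hε)
    obtain ⟨V, hFV, hV, hle'⟩ := hν.outer F hF _ (hc ε hε)
    let N : OC X := ⟨U.1 ∩ V.1, Or.inl (hU.inter hV)⟩
    refine ⟨N, Set.subset_inter hFU hFV, hU.inter hV, ?_⟩
    rw [← hc']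
    have h1 := (hμm N U Set.inter_subset_left).trans hle
    have h2 := (hνm N V Set.inter_subset_right).trans hle'
    gcongr

/-- The deficient topological measure `μ + c ν`. -/
noncomputable def DTM.addSMul (μ ν : DTM X) (c : NNReal) : DTM X where
  toFun A := μ.toFun A + c * ν.toFun A
  isDTM :=
    have hreg := (μ.isDTM.isRegularSetFun μ.finite).add_smul (ν.isDTM.isRegularSetFun ν.finite)
      (fun _ _ => μ.isDTM.mono) (fun _ _ => ν.isDTM.mono) c
    { exists_ne_top := ⟨OC.univ X, ENNReal.add_ne_top.2 ⟨μ.finite.ne,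
        ENNReal.mul_ne_top ENNReal.coe_ne_top ν.finite.ne⟩⟩
      add C K D hC hK hCK hD := by
        rw [μ.isDTM.add C K D hC hK hCK hD, ν.isDTM.add C K D hC hK hCK hD]
        ring
      inner := hreg.inner_eq
      outer := hreg.outer_eq }
  finite := ENNReal.add_lt_top.2 ⟨μ.finite, ENNReal.mul_lt_top ENNReal.coe_lt_top ν.finite⟩

theorem DTM.addSMul_mem_TM {μ ν : DTM X} (hμ : μ ∈ TM X) (hν : ν ∈ TM X) (c : NNReal) :
    μ.addSMul ν c ∈ TM X where
  exists_ne_top := (μ.addSMul ν c).isDTM.exists_ne_top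
  inner := (μ.addSMul ν c).isDTM.inner
  outer := (μ.addSMul ν c).isDTM.outer
  add A B D hA hB hD hAB hDAB := by
    simp only [DTM.addSMul]
    rw [IsTM.add hμ A B D hA hB hD hAB hDAB, IsTM.add hν A B D hA hB hD hAB hDAB]
    ring

variable [MeasurableSpace X] [BorelSpace X]

/-- Monotonicity comes from superadditivity of `ν` together with `m (U \ F) ≤ ν (U \ F)`. The sets
that approximate for `ν` also do so for `ν - m`, since `m` is monotone. -/
theorem isRegularSetFun_sub {ν : DTM X} {m : Measure X} (hle : restrictOC m ≤ ν.toFun) :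
    IsRegularSetFun (fun A => ν.toFun A - restrictOC m A) where
  mono F U hF hU hFU := by
    have hUF : IsOpen (U.1 \ F.1) := hU.sdiff hF
    have hm : restrictOC m U = restrictOC m F + restrictOC m ⟨U.1 \ F.1, Or.inl hUF⟩ := by
      simp only [restrictOC]
      rw [measure_add_sdiff hF.nullMeasurableSet, Set.union_eq_self_of_subset_left hFU]
    refine ENNReal.le_sub_of_add_le_right (measure_ne_top_of_le hle _) ?_
    rw [hm, ← add_assoc, tsub_add_cancel_of_le (hle F)]
    calc ν.toFun F + restrictOC m ⟨U.1 \ F.1, Or.inl hUF⟩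
        ≤ ν.toFun F + ν.toFun ⟨U.1 \ F.1, Or.inl hUF⟩ := by gcongr; exact hle _
      _ ≤ ν.toFun U := ν.isDTM.add_le_open ν.finite hUF hU Set.disjoint_sdiff_right hFU
        Set.sdiff_subset
  inner U hU ε hε := by
    obtain ⟨K, hKU, hK, h⟩ := (ν.isDTM.isRegularSetFun ν.finite).inner U hU ε hε
    refine ⟨K, hKU, hK, ?_⟩
    calc ν.toFun U - restrictOC m U ≤ (ν.toFun K + ε) - restrictOC m K :=
          tsub_le_tsub h (measure_mono hKU)
      _ ≤ ν.toFun K - restrictOC m K + ε := by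
        rw [tsub_le_iff_right, add_right_comm, tsub_add_cancel_of_le (hle K)]
  outer F hF ε hε := by
    obtain ⟨U, hFU, hU, h⟩ := (ν.isDTM.isRegularSetFun ν.finite).outer F hF ε hε
    refine ⟨U, hFU, hU, ?_⟩
    calc ν.toFun U - restrictOC m U ≤ (ν.toFun F + ε) - restrictOC m F :=
          tsub_le_tsub h (measure_mono hFU)
      _ ≤ ν.toFun F - restrictOC m F + ε := by
        rw [tsub_le_iff_right, add_right_comm, tsub_add_cancel_of_le (hle F)]

/-- The difference `ν - m` of a deficient topological measure and a measure below it. -/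
noncomputable def DTM.subMeasure (ν : DTM X) (m : Measure X) (hle : restrictOC m ≤ ν.toFun) :
    DTM X where
  toFun A := ν.toFun A - restrictOC m A
  isDTM :=
    have hreg := isRegularSetFun_sub hle
    { exists_ne_top := ⟨OC.univ X, (tsub_le_self.trans_lt ν.finite).ne⟩
      add C K D hC hK hCK hD := by
        rw [ν.isDTM.add C K D hC hK hCK hD, restrictOC_union hCK hD]
        exact ennreal_add_sub_add_of_le (hle C) (hle K) (measure_ne_top_of_le hle _)
          (measure_ne_top_of_le hle _)
      inner := hreg.inner_eq
      outer := hreg.outer_eq }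
  finite := tsub_le_self.trans_lt ν.finite

theorem DTM.subMeasure_mem_TM {ν : DTM X} {m : Measure X} {hle : restrictOC m ≤ ν.toFun}
    (hν : ν ∈ TM X) : ν.subMeasure m hle ∈ TM X where
  exists_ne_top := (ν.subMeasure m hle).isDTM.exists_ne_top
  inner := (ν.subMeasure m hle).isDTM.inner
  outer := (ν.subMeasure m hle).isDTM.outer
  add A B D hA hB hD hAB hDAB := by
    simp only [DTM.subMeasure]
    rw [IsTM.add hν A B D hA hB hD hAB hDAB, restrictOC_union hAB hDAB]
    exact ennreal_add_sub_add_of_le (hle A) (hle B) (measure_ne_top_of_le hle _)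
      (measure_ne_top_of_le hle _)

theorem DTM.mem_TM_of_subMeasure {ν : DTM X} {m : Measure X} {hle : restrictOC m ≤ ν.toFun}
    (h : ν.subMeasure m hle ∈ TM X) : ν ∈ TM X where
  exists_ne_top := ν.isDTM.exists_ne_top
  inner := ν.isDTM.inner
  outer := ν.isDTM.outer
  add A B D hA hB hD hAB hDAB := by
    have hsub : ∀ E, ν.toFun E = (ν.subMeasure m hle).toFun E + restrictOC m E := fun E =>
      (tsub_add_cancel_of_le (hle E)).symm
    rw [hsub D, hsub A, hsub B, IsTM.add h A B D hA hB hD hAB hDAB, restrictOC_union hAB hDAB,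
      add_add_add_comm]

theorem DTM.mem_M_of_subMeasure_eq_zero {ν : DTM X} {m : Measure X} (hm : IsRegularBorel m)
    {hle : restrictOC m ≤ ν.toFun} (h : (ν.subMeasure m hle).toFun = 0) : ν ∈ M X :=
  ⟨m, hm, le_antisymm (fun A => tsub_eq_zero_iff_le.1 (congrFun h A)) hle⟩

end Constructions

/-! ### Splitting off a measure to leave a proper remainder -/

section MaximalMeasure

variable {X : Type*} [TopologicalSpace X] [T2Space X] [MeasurableSpace X] [BorelSpace X]

theorem isRegularBorel_of_innerRegular {m : Measure X} [IsFiniteMeasure m] [m.InnerRegular] :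
    IsRegularBorel m where
  inner U hU := hU.measure_eq_iSup_isCompact m
  outer E _ := by
    rw [E.measure_eq_iInf_isOpen m]

/-- The supremum need not be shown to be attained: half of it suffices for the exhaustion. -/
theorem exists_measureMass_le (ν : OC X → ℝ≥0∞) (hν : ν (OC.univ X) ≠ ∞) :
    ∃ m : Measure X, IsRegularBorel m ∧ restrictOC m ≤ ν ∧
      measureMass ν ≤ 2 * m Set.univ := by
  rcases eq_or_ne (measureMass ν) 0 with h0 | h0
  · exact ⟨0, isRegularBorel_of_innerRegular, fun _ => zero_le, by simp [h0]⟩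
  · have hfin : measureMass ν ≠ ∞ :=
      ne_top_of_le_ne_top hν (iSup₂_le fun m hm => hm.2 (OC.univ X))
    have hlt := ENNReal.half_lt_self h0 hfin
    conv_rhs at hlt => rw [measureMass]
    simp only [lt_iSup_iff] at hlt
    obtain ⟨m, ⟨hm, hle⟩, hlt⟩ := hlt
    refine ⟨m, hm, hle, ?_⟩
    rw [mul_comm]
    exact (ENNReal.div_le_iff (by simp) (by simp)).1 hlt.le

/-- Every finite deficient topological measure is the sum of a finite regular measure and a proper
deficient topological measure. -/
theorem DTM.exists_isProper_subMeasure (ν : DTM X) :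
    ∃ (m : Measure X) (_ : IsRegularBorel m) (hle : restrictOC m ≤ ν.toFun),
      IsProper (ν.subMeasure m hle).toFun := by
  choose k hk using fun p : Measure X => exists_measureMass_le
    (fun A => ν.toFun A - restrictOC p A) (tsub_le_self.trans_lt ν.finite).ne
  -- `p n` is the part removed after `n` steps; `k (p n)` takes at least half of the mass still
  -- removable from `ν - p n`.
  let p : ℕ → Measure X := fun n => Nat.rec 0 (fun _ q => q + k q) n
  have hp : ∀ n, p (n + 1) = p n + k (p n) := fun n => rfl
  have hple : ∀ n, restrictOC (p n) ≤ ν.toFun := by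
    intro n
    induction n with
    | zero => exact fun _ => zero_le
    | succ n ih =>
      intro A
      have h1 := (hk (p n)).2.1 A
      calc restrictOC (p (n + 1)) A = restrictOC (p n) A + restrictOC (k (p n)) A := by
            rw [hp]; rfl
        _ ≤ restrictOC (p n) A + (ν.toFun A - restrictOC (p n) A) := by gcongr
        _ = ν.toFun A := add_tsub_cancel_of_le (ih A)
  have hkfin : ∀ n, IsFiniteMeasure (k (p n)) := fun n =>
    ⟨((hk (p n)).2.1 (OC.univ X)).trans_lt (tsub_le_self.trans_lt ν.finite)⟩
  have hkreg : ∀ n, (k (p n)).InnerRegular := fun n => (hk (p n)).1.innerRegular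
  have hpsum : ∀ n A, p n A = ∑ i ∈ Finset.range n, k (p i) A := by
    intro n A
    induction n with
    | zero => rfl
    | succ n ih => rw [hp, Finset.sum_range_succ, ← ih]; rfl
  let m : Measure X := Measure.sum fun n => k (p n)
  have hmA : ∀ A : OC X, m A.1 = ⨆ n, p n A.1 := by
    intro A
    have hA : MeasurableSet A.1 := A.2.elim IsOpen.measurableSet IsClosed.measurableSet
    rw [Measure.sum_apply _ hA, ENNReal.tsum_eq_iSup_nat]
    exact iSup_congr fun n => (hpsum n _).symm
  have hmle : restrictOC m ≤ ν.toFun := fun A => by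
    simp only [restrictOC]
    rw [hmA]
    exact iSup_le fun n => hple n A
  have hmfin : IsFiniteMeasure m := ⟨(hmle (OC.univ X)).trans_lt ν.finite⟩
  refine ⟨m, isRegularBorel_of_innerRegular, hmle, fun q hq hqle => ?_⟩
  -- A measure `q` below `ν - m` is below every `ν - p n`, so each step removed at least half of its
  -- mass. The removed masses are summable, which forces `q = 0`.
  have hbound : ∀ n, q Set.univ ≤ 2 * k (p n) Set.univ := by
    intro n
    refine (le_measureMass hq.toIsRegularBorel (hqle.trans ?_)).trans (hk (p n)).2.2
    intro A
    refine tsub_le_tsub_left ?_ _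
    simp only [restrictOC]
    rw [hmA]
    exact le_iSup (fun n => p n A.1) n
  have hsum : ∑' n, k (p n) Set.univ ≠ ∞ := by
    rw [← Measure.sum_apply _ MeasurableSet.univ]
    exact measure_ne_top m _
  have hlim : Tendsto (fun n => 2 * k (p n) Set.univ) atTop (𝓝 (2 * 0)) :=
    ENNReal.Tendsto.const_mul (ENNReal.tendsto_atTop_zero_of_tsum_ne_top hsum) (by simp)
  rw [mul_zero] at hlim
  exact Measure.measure_univ_eq_zero.1 (le_zero_iff.1 (ge_of_tendsto' hlim hbound))

end MaximalMeasure

/-! ### Quasi-integrals and the weak topology -/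

section QuasiIntegral

variable {X : Type*} [TopologicalSpace X]

/-- The value of a finite deficient topological measure as a real number. -/
noncomputable def DTM.real (ν : DTM X) (A : OC X) : ℝ := (ν.toFun A).toReal

theorem DTM.ne_top (ν : DTM X) (A : OC X) : ν.toFun A ≠ ∞ := ν.isDTM.ne_top ν.finite A

theorem DTM.real_nonneg (ν : DTM X) (A : OC X) : 0 ≤ ν.real A := ENNReal.toReal_nonneg

theorem DTM.real_mono (ν : DTM X) {A B : OC X} (h : A.1 ⊆ B.1) : ν.real A ≤ ν.real B :=
  ENNReal.toReal_mono (ν.ne_top B) (ν.isDTM.mono h)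

theorem DTM.real_empty (ν : DTM X) {A : OC X} (h : A.1 = ∅) : ν.real A = 0 := by
  rw [DTM.real, ν.isDTM.empty ν.finite h, ENNReal.toReal_zero]

theorem DTM.exists_isOpen_real_le (ν : DTM X) {F : OC X} (hF : IsClosed F.1) {ε : ℝ}
    (hε : 0 < ε) : ∃ U : OC X, F.1 ⊆ U.1 ∧ IsOpen U.1 ∧ ν.real U ≤ ν.real F + ε := by
  obtain ⟨U, hFU, hU, hle⟩ := (ν.isDTM.isRegularSetFun ν.finite).outer F hF (ENNReal.ofReal ε)
    (by simpa using hε)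
  refine ⟨U, hFU, hU, ?_⟩
  have := ENNReal.toReal_mono (ENNReal.add_ne_top.2 ⟨ν.ne_top F, ENNReal.ofReal_ne_top⟩) hle
  rwa [ENNReal.toReal_add (ν.ne_top F) ENNReal.ofReal_ne_top, ENNReal.toReal_ofReal hε.le] at this

theorem DTM.exists_isCompact_le_real (ν : DTM X) {U : OC X} (hU : IsOpen U.1) {ε : ℝ}
    (hε : 0 < ε) : ∃ K : OC X, K.1 ⊆ U.1 ∧ IsCompact K.1 ∧ ν.real U ≤ ν.real K + ε := by
  obtain ⟨K, hKU, hK, hle⟩ := (ν.isDTM.isRegularSetFun ν.finite).inner U hU (ENNReal.ofReal ε)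
    (by simpa using hε)
  refine ⟨K, hKU, hK, ?_⟩
  have := ENNReal.toReal_mono (ENNReal.add_ne_top.2 ⟨ν.ne_top K, ENNReal.ofReal_ne_top⟩) hle
  rwa [ENNReal.toReal_add (ν.ne_top K) ENNReal.ofReal_ne_top, ENNReal.toReal_ofReal hε.le] at this

theorem apply_le_norm (f : C₀(X, ℝ)) (x : X) : f x ≤ ‖f‖ := by
  rw [← ZeroAtInftyContinuousMap.norm_toBCF_eq_norm]
  exact (le_abs_self _).trans (f.toBCF.norm_coe_le_norm x)

theorem superlevel_eq_empty {f : C₀(X, ℝ)} {b : ℝ} (h : ∀ x, f x ≤ b) :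
    (superlevel f b).1 = ∅ :=
  Set.eq_empty_of_forall_notMem fun x hx => absurd hx (not_lt.2 (h x))

theorem DTM.antitone_superlevel (ν : DTM X) (f : C₀(X, ℝ)) :
    Antitone fun t => ν.real (superlevel f t) := fun _ _ hst =>
  ν.real_mono fun _ hx => hst.trans_lt hx

/-- The quasi-integral may be computed with any upper bound of the function. -/
theorem quasiIntegral_eq (ν : DTM X) (f : C0Plus X) {b : ℝ} (h : ∀ x, f.1 x ≤ b) :
    quasiIntegral ν f = ∫ t in (0 : ℝ)..b, ν.real (superlevel f.1 t) := by
  have hint : ∀ c d, IntervalIntegrable (fun t => ν.real (superlevel f.1 t)) volume c d :=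
    fun _ _ => (ν.antitone_superlevel f.1).intervalIntegrable
  have hzero : ∀ c d, (∀ x, f.1 x ≤ c) → (∀ x, f.1 x ≤ d) →
      ∫ t in c..d, ν.real (superlevel f.1 t) = 0 := by
    intro c d hc hd
    refine intervalIntegral.integral_zero_ae (Eventually.of_forall fun t ht => ?_)
    refine ν.real_empty (superlevel_eq_empty fun x => ?_)
    exact (le_min (hc x) (hd x)).trans ht.1.le
  have h1 := intervalIntegral.integral_add_adjacent_intervals (hint 0 ‖f.1‖) (hint ‖f.1‖ b)
  rw [hzero _ _ (apply_le_norm f.1) h, add_zero] at h1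
  exact h1

/-- Every level below `1` has a superlevel set containing `A`. With `quasiIntegral_le_real` this
translates between values on sets and integrals of Urysohn functions. -/
theorem real_le_quasiIntegral (ν : DTM X) (f : C0Plus X) {A : OC X}
    (h : ∀ x ∈ A.1, 1 ≤ f.1 x) : ν.real A ≤ quasiIntegral ν f := by
  have hb : ∀ x, f.1 x ≤ max 1 ‖f.1‖ := fun x => (apply_le_norm f.1 x).trans (le_max_right _ _)
  have hint : ∀ c d, IntervalIntegrable (fun t => ν.real (superlevel f.1 t)) volume c d :=
    fun _ _ => (ν.antitone_superlevel f.1).intervalIntegrable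
  rw [quasiIntegral_eq ν f hb, ← intervalIntegral.integral_add_adjacent_intervals
    (hint 0 1) (hint 1 _)]
  have h1 : ν.real A ≤ ∫ t in (0 : ℝ)..1, ν.real (superlevel f.1 t) := by
    have := intervalIntegral.integral_mono_on_of_le_Ioo (μ := volume) (a := (0 : ℝ)) (b := 1)
      zero_le_one (f := fun _ => ν.real A) (g := fun t => ν.real (superlevel f.1 t))
      intervalIntegrable_const (hint 0 1) fun t ht =>
        ν.real_mono fun x hx => ht.2.trans_le (h x hx)
    simpa using this
  have h2 : 0 ≤ ∫ t in (1 : ℝ)..max 1 ‖f.1‖, ν.real (superlevel f.1 t) :=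
    intervalIntegral.integral_nonneg (le_max_left _ _) fun t _ => ν.real_nonneg _
  linarith

theorem quasiIntegral_le_real (ν : DTM X) (f : C0Plus X) {A : OC X} (h1 : ∀ x, f.1 x ≤ 1)
    (h : ∀ x, 0 < f.1 x → x ∈ A.1) : quasiIntegral ν f ≤ ν.real A := by
  rw [quasiIntegral_eq ν f h1]
  have := intervalIntegral.integral_mono_on_of_le_Ioo (μ := volume) (a := (0 : ℝ)) (b := 1)
      zero_le_one (f := fun t => ν.real (superlevel f.1 t)) (g := fun _ => ν.real A)
      (ν.antitone_superlevel f.1).intervalIntegrable intervalIntegrable_const fun t ht =>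
        ν.real_mono fun x hx => h x (ht.1.trans hx)
  simpa using this

theorem continuous_quasiIntegral (f : C0Plus X) :
    Continuous fun μ : DTM X => quasiIntegral μ f :=
  continuous_iInf_dom continuous_induced_dom

theorem quasiIntegral_addSMul [T2Space X] (μ ν : DTM X) (c : NNReal) (f : C0Plus X) :
    quasiIntegral (μ.addSMul ν c) f = quasiIntegral μ f + c * quasiIntegral ν f := by
  rw [quasiIntegral_eq (μ.addSMul ν c) f (apply_le_norm f.1),
    quasiIntegral_eq μ f (apply_le_norm f.1), quasiIntegral_eq ν f (apply_le_norm f.1),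
    ← intervalIntegral.integral_const_mul, ← intervalIntegral.integral_add
      (μ.antitone_superlevel f.1).intervalIntegrable
      ((ν.antitone_superlevel f.1).intervalIntegrable.const_mul _)]
  congr 1 with t
  simp only [DTM.real, DTM.addSMul]
  rw [ENNReal.toReal_add (μ.ne_top _) (ENNReal.mul_ne_top ENNReal.coe_ne_top (ν.ne_top _)),
    ENNReal.toReal_mul, ENNReal.coe_toReal]

/-- Each quasi-integral is affine in `c`, and these functionals define the topology. -/
theorem tendsto_addSMul [T2Space X] (μ ν : DTM X) :
    Tendsto (fun c : NNReal => μ.addSMul ν c) (𝓝 0) (𝓝 μ) := by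
  rw [nhds_iInf, tendsto_iInf]
  intro f
  rw [nhds_induced, tendsto_comap_iff]
  have h : Continuous fun c : NNReal => quasiIntegral μ f + c * quasiIntegral ν f := by fun_prop
  have := h.tendsto 0
  simp only [NNReal.coe_zero, zero_mul, add_zero] at this
  refine this.congr fun c => ?_
  exact (quasiIntegral_addSMul μ ν c f).symm

theorem exists_c0Plus [T2Space X] [LocallyCompactSpace X] {K U : Set X} (hK : IsCompact K)
    (hU : IsOpen U) (hKU : K ⊆ U) : ∃ (f : C0Plus X) (S : Set X), IsCompact S ∧ S ⊆ U ∧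
      (∀ x, f.1 x ≠ 0 → x ∈ S) ∧ (∀ x ∈ K, f.1 x = 1) ∧ ∀ x, f.1 x ≤ 1 := by
  obtain ⟨f, hf1, hf2, hf3, hf4⟩ := exists_continuousMap_one_of_isCompact_subset_isOpen hK hU hKU
  exact ⟨⟨⟨f, HasCompactSupport.is_zero_at_infty hf2⟩, fun x => (hf4 x).1⟩, tsupport f, hf2, hf3,
    fun x hx => subset_tsupport f hx, fun x hx => hf1 hx, fun x => (hf4 x).2⟩

/-- For almost every level the strict and the weak superlevel sets have the same value. -/
theorem DTM.ae_real_superlevel_eq (ν : DTM X) (f : C₀(X, ℝ)) (G : ℝ → OC X)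
    (hG : ∀ t, (G t).1 = {x | t ≤ f x}) :
    ∀ᵐ t : ℝ, ν.real (G t) = ν.real (superlevel f t) := by
  -- A monotone function has countably many discontinuities. At a point of continuity `t`, the weak
  -- superlevel set lies in the strict ones of all levels `s < t`.
  have hanti := ν.antitone_superlevel f
  filter_upwards [(hanti.countable_not_continuousAt).ae_notMem volume] with t ht
  have ht : ContinuousAt (fun t => ν.real (superlevel f t)) t := by simpa using ht
  refine le_antisymm ?_ (ν.real_mono ?_)
  · refine ge_of_tendsto (ht.tendsto.mono_left (nhdsWithin_le_nhds (s := Set.Iio t))) ?_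
    filter_upwards [self_mem_nhdsWithin] with s hs
    refine ν.real_mono ?_
    rw [hG]
    intro x (hx : t ≤ f x)
    exact lt_of_lt_of_le (Set.mem_Iio.1 hs) hx
  · rw [hG]
    intro x (hx : t < f x)
    exact hx.le

theorem isCompact_setOf_le (f : C₀(X, ℝ)) {t : ℝ} (ht : 0 < t) : IsCompact {x | t ≤ f x} := by
  have hcl : IsClosed {x | t ≤ f x} := isClosed_le continuous_const f.continuous
  have := f.zero_at_infty' (Iio_mem_nhds ht)
  obtain ⟨K, hK, hsub⟩ := mem_cocompact.1 this
  refine hK.of_isClosed_subset hcl fun x hx => ?_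
  by_contra hxK
  have hlt : f x < t := hsub hxK
  exact absurd hlt (not_lt.2 hx)

end QuasiIntegral

/-! ### Quasi-integrals of measures -/

section Measure

variable {X : Type*} [TopologicalSpace X] [MeasurableSpace X] [BorelSpace X]

/-- The layer-cake formula, cut off at `‖f‖` because higher levels are empty. -/
theorem quasiIntegral_eq_integral {ν : DTM X} {m : Measure X} (hm : ν.toFun = restrictOC m)
    (f : C0Plus X) : Integrable f.1 m ∧ quasiIntegral ν f = ∫ x, f.1 x ∂m := by
  have : IsFiniteMeasure m := ⟨by
    have := ν.finite
    rwa [hm] at this⟩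
  have hint : Integrable f.1 m := f.1.toBCF.integrable m
  refine ⟨hint, ?_⟩
  rw [hint.integral_eq_integral_meas_lt (Eventually.of_forall f.2),
    setIntegral_eq_of_subset_of_forall_sdiff_eq_zero (s := Set.Ioc 0 ‖f.1‖) measurableSet_Ioi
      Set.Ioc_subset_Ioi_self ?_, ← intervalIntegral.integral_of_le (norm_nonneg _),
    quasiIntegral, hm]
  · rfl
  · intro t ht
    have ht' : ‖f.1‖ < t := by
      by_contra! h
      exact ht.2 ⟨ht.1, h⟩
    have : {x | t < f.1 x} = ∅ :=
      superlevel_eq_empty fun x => (apply_le_norm f.1 x).trans ht'.le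
    rw [this, measureReal_empty]

theorem quasiIntegral_add_of_mem_M {ν : DTM X} (hν : ν ∈ M X) {f g h : C0Plus X}
    (hsum : ∀ x, g.1 x = f.1 x + h.1 x) :
    quasiIntegral ν g = quasiIntegral ν f + quasiIntegral ν h := by
  obtain ⟨m, -, hm⟩ := hν
  rw [(quasiIntegral_eq_integral hm g).2, (quasiIntegral_eq_integral hm f).2,
    (quasiIntegral_eq_integral hm h).2, ← integral_add (quasiIntegral_eq_integral hm f).1
      (quasiIntegral_eq_integral hm h).1]
  simp only [hsum]

end Measure

/-! ### Closedness of `TM X` and `M X`, and perturbation out of them -/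

section Closed

variable {X : Type*} [TopologicalSpace X]

/-- A topological measure is additive on `g = f + h` if `g = 1` where `f` does not vanish. -/
theorem quasiIntegral_add_of_mem_TM {ν : DTM X} (hν : ν ∈ TM X) {f g h : C0Plus X}
    (hsum : ∀ x, g.1 x = f.1 x + h.1 x) (hg : ∀ x, g.1 x ≤ 1)
    (hfg : ∀ x, f.1 x ≠ 0 → g.1 x = 1) :
    quasiIntegral ν g = quasiIntegral ν f + quasiIntegral ν h := by
  have hf1 : ∀ x, f.1 x ≤ 1 := fun x => by linarith [hsum x, hg x, h.2 x]
  have hh1 : ∀ x, h.1 x ≤ 1 := fun x => by linarith [hsum x, hg x, f.2 x]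
  let G : ℝ → OC X := fun t =>
    ⟨{x | t ≤ f.1 x}, Or.inr (isClosed_le continuous_const f.1.continuous)⟩
  have hGanti : Antitone fun t => ν.real (G t) := fun s t hst =>
    ν.real_mono fun x hx => le_trans hst hx
  have hGf : ∫ t in (0 : ℝ)..1, ν.real (G (1 - t)) = quasiIntegral ν f := by
    rw [quasiIntegral_eq ν f hf1,
      intervalIntegral.integral_comp_sub_left (fun t => ν.real (G t)) 1, sub_self, sub_zero]
    exact intervalIntegral.integral_congr_ae
      ((ν.ae_real_superlevel_eq f.1 G fun _ => rfl).mono fun t ht _ => ht)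
  have hGint : IntervalIntegrable (fun t => ν.real (G (1 - t))) volume 0 1 := by
    have : Monotone fun t => ν.real (G (1 - t)) := fun s t hst => hGanti (by linarith)
    exact this.intervalIntegrable
  rw [← hGf, quasiIntegral_eq ν h hh1, quasiIntegral_eq ν g hg,
    ← intervalIntegral.integral_add hGint (ν.antitone_superlevel h.1).intervalIntegrable]
  refine intervalIntegral.integral_congr_Ioo_of_le zero_le_one fun t ht => ?_
  -- `{t < g}` splits into the compact `{1 - t ≤ f}` and the open `{t < h}`: where `f ≠ 0` one has
  -- `h = 1 - f`, elsewhere `g = h`. Hence the reversal `t ↦ 1 - t` of the levels of `f`.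
  have hadd := IsTM.add hν (G (1 - t)) (superlevel h.1 t) (superlevel g.1 t)
    (Or.inl (isCompact_setOf_le f.1 (by linarith [ht.2])))
    (Or.inr (isOpen_lt continuous_const h.1.continuous))
    (Or.inr (isOpen_lt continuous_const g.1.continuous)) ?_ ?_
  · simp only [DTM.real]
    rw [hadd, ENNReal.toReal_add (ν.ne_top _) (ν.ne_top _)]
  · rw [Set.disjoint_left]
    intro x (hx : 1 - t ≤ f.1 x) (hx' : t < h.1 x)
    linarith [hsum x, hg x]
  · ext x
    change t < g.1 x ↔ 1 - t ≤ f.1 x ∨ t < h.1 x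
    have h1 := hsum x
    rcases eq_or_ne (f.1 x) 0 with h0 | h0
    · rw [h0, zero_add] at h1
      rw [h1, h0]
      exact ⟨Or.inr, fun h => h.resolve_left (by linarith [ht.2])⟩
    · have h2 := hfg x h0
      constructor
      · intro _
        by_contra! hcon
        linarith
      · intro _
        linarith [ht.2]

variable [T2Space X] [LocallyCompactSpace X]

/-- Test functions replace the sets: `f` is `1` on `C` and lives near it, `g` is `1` on most of `U`
and lives in `U`, so `g - f` lives in `U \ C`. -/
theorem mem_TM_of_quasiIntegral_le {ν : DTM X} (hν : ∀ f g h : C0Plus X,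
    (∀ x, g.1 x = f.1 x + h.1 x) → (∀ x, g.1 x ≤ 1) → (∀ x, f.1 x ≠ 0 → g.1 x = 1) →
      quasiIntegral ν g ≤ quasiIntegral ν f + quasiIntegral ν h) : ν ∈ TM X := by
  refine ν.isDTM.isTM_of_le ν.finite fun C U V hC hU hCU hV => ?_
  have hreal : ν.real U ≤ ν.real C + ν.real V := by
    refine le_of_forall_pos_le_add fun ε hε => ?_
    obtain ⟨W, hCW, hW, hWle⟩ := ν.exists_isOpen_real_le hC.isClosed (half_pos hε)
    obtain ⟨K, hKU, hK, hKle⟩ := ν.exists_isCompact_le_real hU (half_pos hε)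
    obtain ⟨f, S, hS, hSW, hfS, hfC, hf1⟩ := exists_c0Plus hC (hW.inter hU)
      (Set.subset_inter hCW hCU)
    -- Requiring `g = 1` on `S`, which carries `f`, makes the pair admissible and `g - f`
    -- nonnegative.
    obtain ⟨g, T, hT, hTU, hgT, hgS, hg1⟩ := exists_c0Plus (hS.union hK) hU
      (Set.union_subset (hSW.trans Set.inter_subset_right) hKU)
    have hfg : ∀ x, f.1 x ≠ 0 → g.1 x = 1 := fun x hx => hgS x (Or.inl (hfS x hx))
    let h : C0Plus X := ⟨g.1 - f.1, fun x => by
      rw [ZeroAtInftyContinuousMap.coe_sub, Pi.sub_apply]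
      rcases eq_or_ne (f.1 x) 0 with h0 | h0
      · rw [h0, sub_zero]
        exact g.2 x
      · linarith [hfg x h0, hf1 x]⟩
    have hsum : ∀ x, g.1 x = f.1 x + h.1 x := fun x => by
      change g.1 x = f.1 x + (g.1 x - f.1 x)
      ring
    have key := hν f g h hsum hg1 hfg
    have h1 : ν.real K ≤ quasiIntegral ν g :=
      real_le_quasiIntegral ν g fun x hx => (hgS x (Or.inr hx)).ge
    have h2 : quasiIntegral ν f ≤ ν.real W :=
      quasiIntegral_le_real ν f hf1 fun x hx => (hSW (hfS x hx.ne')).1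
    have h3 : quasiIntegral ν h ≤ ν.real V := by
      refine quasiIntegral_le_real ν h (fun x => by linarith [hsum x, hg1 x, f.2 x])
        fun x hx => ?_
      rw [hV]
      refine ⟨hTU (hgT x fun h0 => ?_), fun hxC => ?_⟩
      · linarith [hsum x, f.2 x]
      · linarith [hsum x, hfC x hxC, hg1 x]
    linarith
  rw [← ENNReal.toReal_le_toReal (ν.ne_top _) (ENNReal.add_ne_top.2 ⟨ν.ne_top _, ν.ne_top _⟩),
    ENNReal.toReal_add (ν.ne_top _) (ν.ne_top _)]
  exact hreal

theorem isClosed_TM : IsClosed (TM X) := by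
  have : TM X = ⋂ (f : C0Plus X) (g : C0Plus X) (h : C0Plus X)
      (_ : ∀ x, g.1 x = f.1 x + h.1 x) (_ : ∀ x, g.1 x ≤ 1) (_ : ∀ x, f.1 x ≠ 0 → g.1 x = 1),
      {ν : DTM X | quasiIntegral ν g ≤ quasiIntegral ν f + quasiIntegral ν h} := by
    ext ν
    simp only [Set.mem_iInter]
    exact ⟨fun hν f g h h1 h2 h3 => (quasiIntegral_add_of_mem_TM hν h1 h2 h3).le,
      mem_TM_of_quasiIntegral_le⟩
  rw [this]
  exact isClosed_iInter fun f => isClosed_iInter fun g => isClosed_iInter fun h =>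
    isClosed_iInter fun _ => isClosed_iInter fun _ => isClosed_iInter fun _ =>
      isClosed_le (continuous_quasiIntegral g)
        ((continuous_quasiIntegral f).add (continuous_quasiIntegral h))

/-- If both `μ` and `μ + c ν` are additive on an admissible sum, linearity in the set function makes
`ν` additive there too. -/
theorem addSMul_notMem_TM {μ ν : DTM X} (hμ : μ ∈ TM X) (hν : ν ∉ TM X) {c : NNReal}
    (hc : c ≠ 0) : μ.addSMul ν c ∉ TM X := by
  intro h
  refine hν (mem_TM_of_quasiIntegral_le fun f g k h1 h2 h3 => ?_)
  have e1 := quasiIntegral_add_of_mem_TM h h1 h2 h3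
  have e2 := quasiIntegral_add_of_mem_TM hμ h1 h2 h3
  simp only [quasiIntegral_addSMul] at e1
  have hc' : (c : ℝ) ≠ 0 := by exact_mod_cast hc
  refine (mul_left_cancel₀ hc' ?_).le
  linarith

/-- Subadditivity for overlapping compact sets is the one content axiom a DTM may lack. -/
theorem real_union_le_of_quasiIntegral_le {ν : DTM X} (hν : ∀ f g h : C0Plus X,
    (∀ x, g.1 x = f.1 x + h.1 x) → quasiIntegral ν g ≤ quasiIntegral ν f + quasiIntegral ν h)
    {K L N : OC X} (hK : IsCompact K.1) (hL : IsCompact L.1) (hN : N.1 = K.1 ∪ L.1) :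
    ν.real N ≤ ν.real K + ν.real L := by
  refine le_of_forall_pos_le_add fun ε hε => ?_
  obtain ⟨U, hKU, hU, hUle⟩ := ν.exists_isOpen_real_le hK.isClosed (half_pos hε)
  obtain ⟨V, hLV, hV, hVle⟩ := ν.exists_isOpen_real_le hL.isClosed (half_pos hε)
  obtain ⟨f, S, hS, hSU, hfS, hfK, hf1⟩ := exists_c0Plus hK hU hKU
  obtain ⟨h, T, hT, hTV, hhT, hhL, hh1⟩ := exists_c0Plus hL hV hLV
  let g : C0Plus X := ⟨f.1 + h.1, fun x => add_nonneg (f.2 x) (h.2 x)⟩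
  have key := hν f g h fun x => rfl
  have h1 : ν.real N ≤ quasiIntegral ν g := by
    refine real_le_quasiIntegral ν g fun x hx => ?_
    change 1 ≤ f.1 x + h.1 x
    rw [hN] at hx
    rcases hx with hx | hx
    · linarith [hfK x hx, h.2 x]
    · linarith [hhL x hx, f.2 x]
  have h2 : quasiIntegral ν f ≤ ν.real U :=
    quasiIntegral_le_real ν f hf1 fun x hx => hSU (hfS x hx.ne')
  have h3 : quasiIntegral ν h ≤ ν.real V :=
    quasiIntegral_le_real ν h hh1 fun x hx => hTV (hhT x hx.ne')
  linarith

variable [MeasurableSpace X] [BorelSpace X]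

/-- The values on compact sets form a content, whose induced measure is the required one. It
suffices to compare on open sets, which determine a DTM by outer regularity. -/
theorem mem_M_of_quasiIntegral_le {ν : DTM X} (hν : ∀ f g h : C0Plus X,
    (∀ x, g.1 x = f.1 x + h.1 x) →
      quasiIntegral ν g ≤ quasiIntegral ν f + quasiIntegral ν h) : ν ∈ M X := by
  let oc : TopologicalSpace.Compacts X → OC X := fun K => ⟨K, Or.inr K.isCompact.isClosed⟩
  have htop : ∀ A, ν.toFun A ≠ ∞ := ν.ne_top
  let κ : Content X :=
    { toFun := fun K => (ν.toFun (oc K)).toNNReal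
      mono' := fun K L hKL => ENNReal.toNNReal_mono (htop _) (ν.isDTM.mono hKL)
      sup_disjoint' := fun K L hKL _ _ => by
        rw [ν.isDTM.add (oc K) (oc L) (oc (K ⊔ L)) K.isCompact L.isCompact hKL
          (TopologicalSpace.Compacts.coe_sup K L), ENNReal.toNNReal_add (htop _) (htop _)]
      sup_le' := fun K L => by
        rw [← NNReal.coe_le_coe, NNReal.coe_add]
        exact real_union_le_of_quasiIntegral_le hν (K := oc K) (L := oc L) (N := oc (K ⊔ L))
          K.isCompact L.isCompact (TopologicalSpace.Compacts.coe_sup K L) }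
  have hκ : ∀ K, κ K = ν.toFun (oc K) := fun K => ENNReal.coe_toNNReal (htop _)
  have hopen : ∀ U : OC X, IsOpen U.1 → κ.measure U.1 = ν.toFun U := by
    intro U hU
    rw [κ.measure_apply hU.measurableSet, κ.outerMeasure_of_isOpen U.1 hU, Content.innerContent,
      ν.isDTM.inner U hU]
    apply le_antisymm
    · exact iSup₂_le fun K hKU => (hκ K).trans_le (le_iSup_of_le (oc K) (le_iSup_of_le hKU
        (le_iSup (fun _ : IsCompact (oc K).1 => ν.toFun (oc K)) K.isCompact)))
    · exact iSup_le fun K => iSup₂_le fun hKU hK =>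
        le_iSup₂_of_le (f := fun (K : TopologicalSpace.Compacts X) _ => κ K) ⟨K.1, hK⟩ hKU
          (hκ ⟨K.1, hK⟩).ge
  have : IsFiniteMeasure κ.measure := ⟨by
    rw [← show (OC.univ X).1 = Set.univ from rfl, hopen (OC.univ X) isOpen_univ]
    exact ν.finite⟩
  have hreg : IsRegularBorel κ.measure := isRegularBorel_of_innerRegular
  exact ⟨κ.measure, hreg, ν.isDTM.congr_of_open hreg.isTM.isDTM fun U hU => (hopen U hU).symm⟩

theorem isClosed_M : IsClosed (M X) := by
  have : M X = ⋂ (f : C0Plus X) (g : C0Plus X) (h : C0Plus X)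
      (_ : ∀ x, g.1 x = f.1 x + h.1 x),
      {ν : DTM X | quasiIntegral ν g ≤ quasiIntegral ν f + quasiIntegral ν h} := by
    ext ν
    simp only [Set.mem_iInter]
    exact ⟨fun hν f g h h1 => (quasiIntegral_add_of_mem_M hν h1).le, mem_M_of_quasiIntegral_le⟩
  rw [this]
  exact isClosed_iInter fun f => isClosed_iInter fun g => isClosed_iInter fun h =>
    isClosed_iInter fun _ => isClosed_le (continuous_quasiIntegral g)
        ((continuous_quasiIntegral f).add (continuous_quasiIntegral h))

theorem addSMul_notMem_M {μ ν : DTM X} (hμ : μ ∈ M X) (hν : ν ∉ M X) {c : NNReal}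
    (hc : c ≠ 0) : μ.addSMul ν c ∉ M X := by
  intro h
  refine hν (mem_M_of_quasiIntegral_le fun f g k h1 => ?_)
  have e1 := quasiIntegral_add_of_mem_M h h1
  have e2 := quasiIntegral_add_of_mem_M hμ h1
  simp only [quasiIntegral_addSMul] at e1
  have hc' : (c : ℝ) ≠ 0 := by exact_mod_cast hc
  refine (mul_left_cancel₀ hc' ?_).le
  linarith

end Closed

/-! ### Nowhere density and the example from a connected set -/

/-- A closed set is nowhere dense if each of its points is a limit of points outside it along a
curve. -/
theorem isNowhereDense_of_tendsto {Y : Type*} [TopologicalSpace Y] {S : Set Y} (hS : IsClosed S)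
    (h : ∀ y ∈ S, ∃ γ : NNReal → Y, Tendsto γ (𝓝 0) (𝓝 y) ∧ ∀ c ≠ 0, γ c ∉ S) :
    IsNowhereDense S := by
  rw [IsNowhereDense, hS.closure_eq, Set.eq_empty_iff_forall_notMem]
  intro y hy
  obtain ⟨γ, hγ, hout⟩ := h y (interior_subset hy)
  have hev := hγ (isOpen_interior.mem_nhds hy)
  have hev' : ∀ᶠ c in 𝓝[>] (0 : NNReal), γ c ∈ interior S := nhdsWithin_le_nhds hev
  obtain ⟨c, hc, hc0⟩ := (hev'.and self_mem_nhdsWithin).exists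
  exact hout c (ne_of_gt hc0) (interior_subset hc)

theorem exists_notMem_of_isNowhereDense {Y : Type*} [TopologicalSpace Y] [Nonempty Y] {S : Set Y}
    (h : IsNowhereDense S) : ∃ y, y ∉ S := by
  by_contra! hall
  rw [Set.eq_univ_of_forall hall, IsNowhereDense, closure_univ, interior_univ] at h
  exact Set.univ_nonempty.ne_empty h

variable {X : Type*} [TopologicalSpace X]

theorem isTM_zero : IsTM (0 : OC X → ℝ≥0∞) where
  exists_ne_top := ⟨OC.univ X, by simp⟩
  add := by simp
  inner := by simp
  outer F _ := le_antisymm zero_le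
    (iInf_le_of_le (OC.univ X) (iInf₂_le_of_le (Set.subset_univ _) isOpen_univ le_rfl))

/-- The zero deficient topological measure. -/
def DTM.zero (X : Type*) [TopologicalSpace X] : DTM X := ⟨0, isTM_zero.isDTM, by simp⟩

instance : Nonempty (DTM X) := ⟨DTM.zero X⟩

instance : Nonempty (TM X) := ⟨⟨DTM.zero X, isTM_zero⟩⟩

theorem notMem_M_of_isProper [MeasurableSpace X] {ν : DTM X} (h0 : ν.toFun ≠ 0)
    (hν : IsProper ν.toFun) : ν ∉ M X := by
  rintro ⟨m, hm, hνm⟩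
  have hfin : m Set.univ < ∞ := by
    have := ν.finite
    rwa [hνm] at this
  have hm0 : m = 0 := hν m { toIsRegularBorel := hm
                             compact_finite := fun K _ =>
                              (measure_mono (Set.subset_univ K)).trans_lt hfin } hνm.ge
  refine h0 (hνm.trans ?_)
  rw [hm0]
  rfl

/-- The set function which is `1` on the supersets of a connected compact set and `0` elsewhere. -/
noncomputable def indicatorDTM [T2Space X] (K : Set X) (hK : IsCompact K) (hc : IsConnected K) :
    DTM X where
  toFun A := open Classical in if K ⊆ A.1 then 1 else 0
  finite := by split_ifs <;> simp
  isDTM :=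
    { exists_ne_top := ⟨OC.univ X, by split_ifs <;> simp⟩
      add := by
        intro C L D hC hL hCL hD
        -- A connected `K` inside two disjoint closed sets lies in one of them; being nonempty, it
        -- cannot lie in both.
        have hor : K ⊆ D.1 ↔ K ⊆ C.1 ∨ K ⊆ L.1 := by
          rw [hD]
          refine ⟨fun h => ?_, fun h => h.elim (fun h => h.trans Set.subset_union_left)
            fun h => h.trans Set.subset_union_right⟩
          exact isPreconnected_iff_subset_of_disjoint_closed.1 hc.isPreconnected C.1 L.1
            hC.isClosed hL.isClosed h (by rw [hCL.inter_eq, Set.inter_empty])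
        have hnot : ¬ (K ⊆ C.1 ∧ K ⊆ L.1) := by
          rintro ⟨h1, h2⟩
          obtain ⟨x, hx⟩ := hc.nonempty
          exact hCL.le_bot ⟨h1 hx, h2 hx⟩
        by_cases h1 : K ⊆ C.1 <;> by_cases h2 : K ⊆ L.1 <;> simp_all
      inner := by
        intro U hU
        apply le_antisymm
        · split_ifs with h
          · refine le_iSup_of_le ⟨K, Or.inr hK.isClosed⟩ (le_iSup_of_le h (le_iSup_of_le hK ?_))
            simp
          · exact zero_le
        · refine iSup_le fun C => iSup₂_le fun hCU _ => ?_
          by_cases h : K ⊆ C.1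
          · simp [h, h.trans hCU]
          · simp [h]
      outer := by
        intro F hF
        apply le_antisymm
        · refine le_iInf fun U => le_iInf₂ fun hFU _ => ?_
          by_cases h : K ⊆ F.1
          · simp [h, h.trans hFU]
          · simp [h]
        · by_cases h : K ⊆ F.1
          · exact iInf_le_of_le (OC.univ X) (iInf₂_le_of_le (Set.subset_univ _) isOpen_univ
              (by simp [h, OC.univ]))
          -- Removing one point of `K \ F` gives an open set around `F` that does not contain `K`.
          · obtain ⟨x, hxK, hxF⟩ := Set.not_subset.1 h
            refine iInf_le_of_le ⟨{x}ᶜ, Or.inl isOpen_compl_singleton⟩ (iInf₂_le_of_le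
              (Set.subset_compl_singleton_iff.2 hxF) isOpen_compl_singleton ?_)
            have : ¬ K ⊆ {x}ᶜ := fun h => h hxK rfl
            simp [this] }

theorem indicatorDTM_notMem_TM [T2Space X] {K : Set X} (hK : IsCompact K) (hc : IsConnected K)
    (hnt : K.Nontrivial) : indicatorDTM K hK hc ∉ TM X := by
  intro h
  obtain ⟨x, hx, y, hy, hxy⟩ := hnt
  -- A point of `K` and its complement both have value `0`, while the whole space has value `1`.
  have hadd := IsTM.add h ⟨{x}, Or.inr isClosed_singleton⟩
    ⟨{x}ᶜ, Or.inl isOpen_compl_singleton⟩ (OC.univ X) (Or.inl isCompact_singleton)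
    (Or.inr isOpen_compl_singleton) (Or.inr isOpen_univ) disjoint_compl_right
    (Set.union_compl_self _).symm
  have h1 : ¬ K ⊆ {x} := fun h => hxy (h hy).symm
  have h2 : ¬ K ⊆ {x}ᶜ := fun h => h hx rfl
  simp [indicatorDTM, OC.univ, h1, h2, -Set.subset_singleton_iff] at hadd

variable [T2Space X] [LocallyCompactSpace X]

theorem isNowhereDense_TM {ν : DTM X} (hν : ν ∉ TM X) : IsNowhereDense (TM X) :=
  isNowhereDense_of_tendsto isClosed_TM fun μ hμ => ⟨fun c => μ.addSMul ν c, tendsto_addSMul μ ν,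
    fun _ hc => addSMul_notMem_TM hμ hν hc⟩

variable [MeasurableSpace X] [BorelSpace X]

theorem isNowhereDense_M {ν : DTM X} (hν : ν ∉ M X) : IsNowhereDense (M X) :=
  isNowhereDense_of_tendsto isClosed_M fun μ hμ => ⟨fun c => μ.addSMul ν c, tendsto_addSMul μ ν,
    fun _ hc => addSMul_notMem_M hμ hν hc⟩

theorem isNowhereDense_M_in_TM {ν : DTM X} (hνT : ν ∈ TM X) (hν : ν ∉ M X) :
    IsNowhereDense {μ : TM X | (μ : DTM X) ∈ M X} :=
  isNowhereDense_of_tendsto (isClosed_M.preimage continuous_subtype_val) fun μ hμ =>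
    ⟨fun c => ⟨μ.1.addSMul ν c, DTM.addSMul_mem_TM μ.2 hνT c⟩,
      tendsto_subtype_rng.2 (tendsto_addSMul μ.1 ν), fun _ hc => addSMul_notMem_M hμ hν hc⟩

end TopMeas

/-! ### The equivalences and the connected case -/

theorem mainTheorem12 (X : Type*) [TopologicalSpace X] [T2Space X] [LocallyCompactSpace X]
    [MeasurableSpace X] [BorelSpace X] :
    -- `𝐌(X)` in `𝐃𝐓𝐌(X)`
    List.TFAE [
      IsNowhereDense (TopMeas.M X),
      ∃ ν : TopMeas.DTM X, ν ∉ TopMeas.M X,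
      ∃ ν : TopMeas.DTM X, ν.toFun ≠ 0 ∧ TopMeas.IsProper ν.toFun] ∧
    -- `𝐌(X)` in the subspace `𝐓𝐌(X)`
    List.TFAE [
      IsNowhereDense {μ : TopMeas.TM X | (μ : TopMeas.DTM X) ∈ TopMeas.M X},
      ∃ μ ∈ TopMeas.TM X, μ ∉ TopMeas.M X,
      ∃ μ ∈ TopMeas.TM X, μ.toFun ≠ 0 ∧ TopMeas.IsProper μ.toFun] ∧
    -- `𝐓𝐌(X)` in `𝐃𝐓𝐌(X)`
    List.TFAE [
      IsNowhereDense (TopMeas.TM X),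
      ∃ ν : TopMeas.DTM X, ν ∉ TopMeas.TM X,
      ∃ ν : TopMeas.DTM X, ν.toFun ≠ 0 ∧ TopMeas.IsProper ν.toFun ∧ ν ∉ TopMeas.TM X] ∧
    -- the two corollaries
    ((∃ K : Set X, IsCompact K ∧ IsConnected K ∧ K.Nontrivial) →
      IsNowhereDense (TopMeas.M X) ∧ IsNowhereDense (TopMeas.TM X)) := by
  open TopMeas in
  refine ⟨?_, ?_, ?_, ?_⟩
  · tfae_have 1 → 2 := exists_notMem_of_isNowhereDense
    tfae_have 2 → 3 := by
      rintro ⟨ν, hν⟩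
      obtain ⟨m, hm, hle, hprop⟩ := ν.exists_isProper_subMeasure
      exact ⟨_, fun h0 => hν (DTM.mem_M_of_subMeasure_eq_zero hm h0), hprop⟩
    tfae_have 3 → 1 := fun ⟨ν, h0, hν⟩ => isNowhereDense_M (notMem_M_of_isProper h0 hν)
    tfae_finish
  · tfae_have 1 → 2 := fun h =>
      let ⟨μ, hμ⟩ := exists_notMem_of_isNowhereDense h
      ⟨μ.1, μ.2, hμ⟩
    tfae_have 2 → 3 := by
      rintro ⟨ν, hνT, hν⟩
      obtain ⟨m, hm, hle, hprop⟩ := ν.exists_isProper_subMeasure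
      exact ⟨_, DTM.subMeasure_mem_TM hνT,
        fun h0 => hν (DTM.mem_M_of_subMeasure_eq_zero hm h0), hprop⟩
    tfae_have 3 → 1 := fun ⟨ν, hνT, h0, hν⟩ =>
      isNowhereDense_M_in_TM hνT (notMem_M_of_isProper h0 hν)
    tfae_finish
  · tfae_have 1 → 2 := exists_notMem_of_isNowhereDense
    tfae_have 2 → 3 := by
      rintro ⟨ν, hν⟩
      obtain ⟨m, hm, hle, hprop⟩ := ν.exists_isProper_subMeasure
      -- Adding `m` back to a TM would make `ν` a TM. The remainder is then also nonzero, since zero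
      -- is a TM.
      have hT : ν.subMeasure m hle ∉ TM X := fun h => hν (DTM.mem_TM_of_subMeasure h)
      refine ⟨_, fun h0 => hT ?_, hprop, hT⟩
      change IsTM (ν.subMeasure m hle).toFun
      rw [h0]
      exact isTM_zero
    tfae_have 3 → 1 := fun ⟨ν, _, _, hν⟩ => isNowhereDense_TM hν
    tfae_finish
  · rintro ⟨K, hK, hc, hnt⟩
    have hT := indicatorDTM_notMem_TM hK hc hnt
    refine ⟨isNowhereDense_M (ν := indicatorDTM K hK hc) ?_, isNowhereDense_TM hT⟩
    rintro ⟨m, hm, h⟩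
    refine hT ?_
    change IsTM (indicatorDTM K hK hc).toFun
    rw [h]
    exact hm.isTM
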